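/- Let $\Gamma$ be a finitely generated group with property (B): for every $\gamma\in\Gamma$ there are an integer $m$ and a homomorphism $\rho\colon\Gamma\to\mathrm{SL}(m,\mathbb{C})$ such that $\operatorname{Tr}\rho(\gamma)\neq\operatorname{Tr}\rho(\eta)$ for every $\eta\in\Gamma$ that is not conjugate to $\gamma$. For $\gamma,\eta\in\Gamma$ let $\mathrm{Con}_\Gamma([\gamma],[\eta])\in\mathbb{N}\cup\{\infty\}$ be the least order of a finite group $Q$ for which there is a homomorphism $\varphi\colon\Gamma\to Q$ with $\varphi(\gamma)$ and $\varphi(\eta)$ not conjugate in $Q$ ($\infty$ if there is none). For a finite generating set $X$ of $\Gamma$, let $\|[\eta]\|_X$ be the least word length with respect to $X$ of an element of the conjugacy class $[\eta]$, and put $$\mathrm{Conj}_{\Gamma,\gamma,X}(n)=\max\{\mathrm{Con}_\Gamma([\gamma],[\eta]) : \|[\eta]\|_X\le n,\ [\eta]\ne[\gamma]\}$$ (with the maximum of the empty set equal to $0$). Then for each $\gamma\in\Gamma$ there is $d_\gamma\in\mathbb{N}$, not depending on $X$, such that for every finite generating set $X$ of $\Gamma$ we have $\mathrm{Conj}_{\Gamma,\gamma,X}(n)\preceq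 n^{d_\gamma}$; that is, there is a positive integer $C$ with $$\mathrm{Conj}_{\Gamma,\gamma,X}(n)\le C\,(Cn)^{d_\gamma}\quad\text{for all integers } n\ge 1.$$ -/

import Mathlib

/-- `Dominated f g` is the relation `f ≼ g`: there is a positive integer `C` with
`f n ≤ C * g (C * n)` for every positive integer `n`. -/
def Dominated (f g : ℕ → ℕ∞) : Prop :=
  ∃ C : ℕ, 0 < C ∧ ∀ n : ℕ, 1 ≤ n → f n ≤ (C : ℕ∞) * g (C * n)

/-- Property (B): for every `γ` there is a finite-dimensional representation into `SL(m, ℂ)`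
whose trace separates `γ` from every element that is not conjugate to `γ`. -/
def PropertyB (Γ : Type*) [Group Γ] : Prop :=
  ∀ γ : Γ, ∃ (m : ℕ) (ρ : Γ →* Matrix.SpecialLinearGroup (Fin m) ℂ), ∀ η : Γ, ¬ IsConj γ η →
    Matrix.trace (ρ γ : Matrix (Fin m) (Fin m) ℂ) ≠
      Matrix.trace (ρ η : Matrix (Fin m) (Fin m) ℂ)

/-- The word length of `g` with respect to `X`: the least length of a word in the letters
`X ∪ X⁻¹` that represents `g` (`⊤` if there is no such word). -/
noncomputable def wordLength {Γ : Type*} [Group Γ] (X : Set Γ) (g : Γ) : ℕ∞ :=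
  sInf {k : ℕ∞ | ∃ l : List Γ, (∀ x ∈ l, x ∈ X ∨ x⁻¹ ∈ X) ∧ l.prod = g ∧ k = (l.length : ℕ∞)}

/-- The length of a conjugacy class: the least word length of its elements. -/
noncomputable def classLength {Γ : Type*} [Group Γ] (X : Set Γ) (c : ConjClasses Γ) : ℕ∞ :=
  sInf {k : ℕ∞ | ∃ g : Γ, ConjClasses.mk g = c ∧ k = wordLength X g}

/-- The ball of radius `n` in the set of conjugacy classes. -/
def classBall {Γ : Type*} [Group Γ] (X : Set Γ) (n : ℕ) : Set (ConjClasses Γ) :=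
  {c | classLength X c ≤ (n : ℕ∞)}

/-- `Con_Γ(c, c')`: the least order of a finite group `Q` for which some homomorphism `Γ → Q`
maps the classes `c` and `c'` to distinct conjugacy classes of `Q`
(`⊤` if there is no such `Q`). Every finite group has an isomorphic copy in `Type`. -/
noncomputable def conjDepth {Γ : Type*} [Group Γ] (c c' : ConjClasses Γ) : ℕ∞ :=
  sInf {k : ℕ∞ | ∃ (Q : Type) (_ : Group Q) (_ : Finite Q) (φ : Γ →* Q),
    ConjClasses.map φ c ≠ ConjClasses.map φ c' ∧ k = (Nat.card Q : ℕ∞)}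

/-- The relative conjugacy complexity `Conj_{Γ,γ,X}(n)`: the maximum of `Con_Γ([γ], c)` over the
classes `c ≠ [γ]` in the ball of radius `n` (a finite set if `X` is finite). -/
noncomputable def relConjComplexity {Γ : Type*} [Group Γ] (X : Set Γ) (γ : Γ) (n : ℕ) : ℕ∞ :=
  ⨆ c ∈ {c : ConjClasses Γ | c ∈ classBall X n ∧ ConjClasses.mk γ ≠ c},
    conjDepth (ConjClasses.mk γ) c

/-! Traces are conjugacy invariants, so it suffices to keep `Tr ρ(γ) ≠ Tr ρ(η)` after reduction to a
small finite ring. The entries of `ρ` on generators are algebraic over `K = Frac ℤ[B]` for a finite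
algebraically independent set `B`; they lie in a ring `R` of finite dimension `e` over `K`, and left
multiplication embeds `R` in the `e × e` matrices over `K` (`exists_subring_injective_matrix`).

For a word `η` of length at most `n`, powers of one common denominator `s` turn some entry of the
difference of the traces into a nonzero integer polynomial `G` of degree `O(n)`. At a suitable
integer point with coordinates `O(n)`, `s * G` is a nonzero integer with `O(n²)` bits, so some prime
`p = O(n⁴)` does not divide it (`exists_prime_not_dvd_eval`). Evaluating there modulo `p` yields a
commutative ring of order at most `p ^ (e²)`, whose `SL(m)` has order at most `p ^ (e² m²)` and
separates the classes (`exists_finite_quotient_trace`). As `e` and `m` come from `ρ` and one fixed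
generating set, `X` affects only the constant. -/

/-! ### A small prime not dividing a given integer -/

/-- Otherwise `lcm(1, …, 2 ^ k)` divides `z ^ k`, since prime powers up to `2 ^ k` have exponent at
most `k`. Chebyshev's lower bound for the lcm then contradicts the size of `z`. -/
theorem exists_prime_le_not_dvd {z L : ℕ} (hz : z ≠ 0) (hL : z ≤ 2 ^ L) :
    ∃ p : ℕ, p.Prime ∧ p ≤ 16 * (L + 1) ^ 2 ∧ ¬ p ∣ z := by
  by_contra! hp
  obtain ⟨l, hl1, hl2⟩ : ∃ l, L + 1 < 2 ^ l ∧ 2 ^ l ≤ 2 * (L + 1) :=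
    ⟨Nat.log 2 (L + 1) + 1, Nat.lt_pow_succ_log_self one_lt_two _, by
      have := Nat.pow_log_le_self 2 (Nat.succ_ne_zero L)
      rw [pow_succ]; simp only [Nat.succ_eq_add_one] at this; omega⟩
  set k := 2 * l + 2 with hk
  have hk4 : 2 ^ k = 4 * 2 ^ l * 2 ^ l := by rw [hk, pow_add, two_mul, pow_add]; ring
  have hn : 2 ^ k ≤ 16 * (L + 1) ^ 2 := by
    rw [hk4]; nlinarith
  have hdvd : Nat.lcmUpto (2 ^ k) ∣ z ^ k := by
    rw [Nat.lcmUpto_eq_prod_pow_log]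
    refine Finset.prod_dvd_of_isRelPrime ?_ ?_
    · intro p hp' q hq' hpq
      have h1 := (Nat.mem_primesLE.1 hp').2
      have h2 := (Nat.mem_primesLE.1 hq').2
      exact (Nat.coprime_iff_isRelPrime.1 (Nat.Coprime.pow _ _ ((Nat.coprime_primes h1 h2).2 hpq)))
    · intro p hp'
      obtain ⟨h1, h2⟩ := Nat.mem_primesLE.1 hp'
      refine (pow_dvd_pow_of_dvd (hp p h2 (h1.trans hn)) _).trans (pow_dvd_pow _ ?_)
      calc Nat.log p (2 ^ k) ≤ Nat.log 2 (2 ^ k) := Nat.log_anti_left one_lt_two h2.two_le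
        _ = k := Nat.log_pow one_lt_two _
  have h1 := Chebyshev.two_pow_le_mul_lcmUpto (2 ^ k)
  have h2 : Nat.lcmUpto (2 ^ k) ≤ 2 ^ (L * k) := by
    refine (Nat.le_of_dvd (by positivity) hdvd).trans ?_
    rw [pow_mul]; exact Nat.pow_le_pow_left hL _
  have h3 : 2 ^ k + 1 ≤ 2 ^ (k + 1) := by
    have := Nat.one_le_two_pow (n := k)
    calc 2 ^ k + 1 ≤ 2 ^ k + 2 ^ k := by omega
      _ = _ := by ring
  have h4 : 2 ^ (2 ^ k) ≤ 2 ^ (k + 1 + L * k) := by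
    rw [pow_add 2 (k + 1)]; exact h1.trans (Nat.mul_le_mul h3 h2)
  have h5 := (Nat.pow_le_pow_iff_right one_lt_two).1 h4
  have h6 : l < 2 ^ l := Nat.lt_two_pow_self
  rw [hk4, hk] at h5
  nlinarith

/-- The source of the exponent 4: a bit length quadratic in `n`, squared by the prime bound. -/
theorem sixteen_mul_sq_le_mul_pow_four (w D B k : ℕ) {n : ℕ} (hn : 1 ≤ n) :
    16 * ((w + D * (B * n + 1)) * (n + k + 3) + 1) ^ 2 ≤
      16 * ((w + D * (B + 1)) * (k + 4) + 1) ^ 2 * n ^ 4 := by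
  have h5 : (w + D * (B * n + 1)) * (n + k + 3) + 1 ≤
      ((w + D * (B + 1)) * (k + 4) + 1) * n ^ 2 := by
    have h6 : w + D * (B * n + 1) ≤ (w + D * (B + 1)) * n := by
      have h1 : B * n + 1 ≤ (B + 1) * n := by nlinarith
      have h2 : w ≤ w * n := Nat.le_mul_of_pos_right _ hn
      calc _ ≤ w * n + D * ((B + 1) * n) := add_le_add h2 (Nat.mul_le_mul le_rfl h1)
        _ = _ := by ring
    have h7 : n + k + 3 ≤ (k + 4) * n := by nlinarith
    have h8 := Nat.mul_le_mul h6 h7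
    have h9 : 1 ≤ n ^ 2 := Nat.one_le_pow _ _ hn
    calc _ ≤ (w + D * (B + 1)) * n * ((k + 4) * n) + n ^ 2 := add_le_add h8 h9
      _ = _ := by ring
  calc 16 * ((w + D * (B * n + 1)) * (n + k + 3) + 1) ^ 2
      ≤ 16 * (((w + D * (B + 1)) * (k + 4) + 1) * n ^ 2) ^ 2 :=
        Nat.mul_le_mul le_rfl (Nat.pow_le_pow_left h5 2)
    _ = _ := by ring

/-! ### Degrees and values of integer polynomials -/

namespace MvPolynomial

theorem exists_eval_ne_zero_of_totalDegree_le {σ : Type*} [Finite σ] {f : MvPolynomial σ ℤ}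
    (hf : f ≠ 0) {M : ℕ} (hM : f.totalDegree ≤ M) :
    ∃ c : σ → ℤ, (∀ i, |c i| ≤ M) ∧ eval c f ≠ 0 := by
  by_contra! h
  refine hf (eq_zero_of_eval_zero_at_prod_finset f (fun _ => Finset.Icc 0 (M : ℤ)) ?_ ?_)
  · intro i
    have := degreeOf_le_totalDegree f i
    simp; omega
  · intro x hx
    refine h x fun i => ?_
    have := Finset.mem_Icc.1 (hx i)
    rw [abs_of_nonneg this.1]; exact this.2

/-- `f.GrowthLE A D`: the values of `f` at the integer points of norm at most `M` are bounded by
`A * (M + 1) ^ D`. -/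
def GrowthLE {σ : Type*} (f : MvPolynomial σ ℤ) (A D : ℕ) : Prop :=
  ∀ (M : ℕ) (c : σ → ℤ), (∀ i, |c i| ≤ M) → |eval c f| ≤ A * ((M : ℤ) + 1) ^ D

theorem GrowthLE.mono {σ : Type*} {f : MvPolynomial σ ℤ} {A D A' D' : ℕ} (h : f.GrowthLE A D)
    (hA : A ≤ A') (hD : D ≤ D') : f.GrowthLE A' D' := by
  intro M c hc
  refine (h M c hc).trans ?_
  have : (1 : ℤ) ≤ M + 1 := by omega
  gcongr

theorem exists_growthLE {σ : Type*} (f : MvPolynomial σ ℤ) : ∃ A D : ℕ, f.GrowthLE A D := by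
  induction f using MvPolynomial.induction_on with
  | C a => exact ⟨a.natAbs, 0, fun M c _ => by simp⟩
  | add p q hp hq =>
    obtain ⟨A, D, hp⟩ := hp
    obtain ⟨B, E, hq⟩ := hq
    refine ⟨A + B, D + E, fun M c hc => ?_⟩
    have h1 := hp.mono le_rfl (Nat.le_add_right D E) M c hc
    have h2 := hq.mono le_rfl (Nat.le_add_left E D) M c hc
    rw [map_add]
    refine (abs_add_le _ _).trans ?_
    push_cast
    linarith
  | mul_X p i hp =>
    obtain ⟨A, D, hp⟩ := hp
    refine ⟨A, D + 1, fun M c hc => ?_⟩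
    rw [map_mul, eval_X, abs_mul, pow_succ, ← mul_assoc]
    have := hc i
    exact mul_le_mul (hp M c hc) (by linarith) (abs_nonneg _) (by positivity)

theorem exists_growthLE_of_finite {σ : Type*} {S : Set (MvPolynomial σ ℤ)} (hS : S.Finite) :
    ∃ A D : ℕ, ∀ f ∈ S, f.GrowthLE A D := by
  choose A D h using exists_growthLE (σ := σ)
  refine ⟨∑ f ∈ hS.toFinset, A f, ∑ f ∈ hS.toFinset, D f, fun f hf => (h f).mono ?_ ?_⟩
  · exact Finset.single_le_sum (f := A) (fun _ _ => Nat.zero_le _) (hS.mem_toFinset.2 hf)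
  · exact Finset.single_le_sum (f := D) (fun _ _ => Nat.zero_le _) (hS.mem_toFinset.2 hf)

theorem exists_totalDegree_le_of_finite {σ : Type*} {S : Set (MvPolynomial σ ℤ)} (hS : S.Finite) :
    ∃ D : ℕ, ∀ f ∈ S, f.totalDegree ≤ D :=
  ⟨∑ f ∈ hS.toFinset, f.totalDegree, fun _ hf => Finset.single_le_sum
    (f := totalDegree) (fun _ _ => Nat.zero_le _) (hS.mem_toFinset.2 hf)⟩

variable {σ κ : Type*} [Fintype κ] [DecidableEq κ]

theorem totalDegree_list_prod_apply_le {D : ℕ} (l : List (Matrix κ κ (MvPolynomial σ ℤ)))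
    (hl : ∀ U ∈ l, ∀ i j, (U i j).totalDegree ≤ D) (i j : κ) :
    (l.prod i j).totalDegree ≤ D * l.length := by
  induction l generalizing i j with
  | nil =>
    rw [List.prod_nil, Matrix.one_apply]
    split_ifs <;> simp
  | cons U l ih =>
    rw [List.prod_cons, Matrix.mul_apply]
    refine totalDegree_finsetSum_le fun k _ => (totalDegree_mul _ _).trans ?_
    have h1 := hl U (by simp) i k
    have h2 := ih (fun V hV => hl V (by simp [hV])) k j
    rw [List.length_cons, mul_add, mul_one]; omega

theorem abs_eval_list_prod_apply_le {H : ℤ} (hH : 0 ≤ H) (c : σ → ℤ)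
    (l : List (Matrix κ κ (MvPolynomial σ ℤ)))
    (hl : ∀ U ∈ l, ∀ i j, |eval c (U i j)| ≤ H) (i j : κ) :
    |eval c (l.prod i j)| ≤ (Fintype.card κ * H) ^ l.length := by
  induction l generalizing i j with
  | nil =>
    rw [List.prod_nil, Matrix.one_apply]
    split_ifs <;> simp
  | cons U l ih =>
    rw [List.prod_cons, Matrix.mul_apply, map_sum]
    refine (Finset.abs_sum_le_sum_abs _ _).trans ?_
    have : ∀ k ∈ Finset.univ, |eval c (U i k * l.prod k j)| ≤
        H * (Fintype.card κ * H) ^ l.length := fun k _ => by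
      rw [map_mul, abs_mul]
      exact mul_le_mul (hl U (by simp) i k) (ih (fun V hV => hl V (by simp [hV])) k j)
        (abs_nonneg _) hH
    refine (Finset.sum_le_card_nsmul _ _ _ this).trans (le_of_eq ?_)
    rw [List.length_cons, pow_succ, nsmul_eq_mul, Finset.card_univ]; ring

/-- The extra factor `s` makes the denominator invertible modulo `p` as well. -/
theorem exists_prime_not_dvd_eval [Finite σ] {S : Set (Matrix κ κ (MvPolynomial σ ℤ))}
    (hS : S.Finite) (s g : MvPolynomial σ ℤ) (hs : s ≠ 0) (k : ℕ) (T : Finset (κ × κ)) :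
    ∃ C : ℕ, ∀ n : ℕ, 1 ≤ n → ∀ l : List (Matrix κ κ (MvPolynomial σ ℤ)), (∀ U ∈ l, U ∈ S) →
      l.length ≤ n → s ^ l.length * g - s ^ k * ∑ q ∈ T, l.prod q.1 q.2 ≠ 0 →
      ∃ (c : σ → ℤ) (p : ℕ), p.Prime ∧ p ≤ C * n ^ 4 ∧
        ¬ (p : ℤ) ∣ eval c (s * (s ^ l.length * g - s ^ k * ∑ q ∈ T, l.prod q.1 q.2)) := by
  set S' : Set (MvPolynomial σ ℤ) :=
    {s, g} ∪ (fun x : Matrix κ κ (MvPolynomial σ ℤ) × κ × κ => x.1 x.2.1 x.2.2) ''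
      (S ×ˢ Set.univ)
  have hS' : S'.Finite :=
    (Set.toFinite _).union ((hS.prod Set.finite_univ).image _)
  have hmem : ∀ U ∈ S, ∀ i j, U i j ∈ S' := fun U hU i j =>
    Or.inr ⟨(U, i, j), ⟨hU, trivial⟩, rfl⟩
  have hmems : s ∈ S' := Or.inl (by simp)
  have hmemg : g ∈ S' := Or.inl (by simp)
  obtain ⟨A, D, hA⟩ := exists_growthLE_of_finite hS'
  obtain ⟨E, hE⟩ := exists_totalDegree_le_of_finite hS'
  set w : ℕ := (Fintype.card κ + 1) * (T.card + 2) * (A + 1) with hw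
  set B : ℕ := E * (k + 3) with hB
  refine ⟨16 * ((w + D * (B + 1)) * (k + 4) + 1) ^ 2, fun n hn l hl hln hG => ?_⟩
  set G := s ^ l.length * g - s ^ k * ∑ q ∈ T, l.prod q.1 q.2 with hGdef
  have hdeg : (s * G).totalDegree ≤ B * n := by
    have hds := hE s hmems
    have hdg := hE g hmemg
    have h1 : (s ^ l.length * g).totalDegree ≤ E * n + E := by
      refine (totalDegree_mul _ _).trans (add_le_add ((totalDegree_pow _ _).trans ?_) hdg)
      rw [mul_comm E]; exact Nat.mul_le_mul hln hds
    have h2 : (s ^ k * ∑ q ∈ T, l.prod q.1 q.2).totalDegree ≤ E * k + E * n := by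
      refine (totalDegree_mul _ _).trans (add_le_add ((totalDegree_pow _ _).trans ?_) ?_)
      · rw [mul_comm E]; exact Nat.mul_le_mul le_rfl hds
      · refine totalDegree_finsetSum_le fun q _ => ?_
        exact (totalDegree_list_prod_apply_le l (fun U hU i j => hE _ (hmem U (hl U hU) i j))
          _ _).trans (Nat.mul_le_mul le_rfl hln)
    have h3 : G.totalDegree ≤ max (E * n + E) (E * k + E * n) :=
      (totalDegree_sub _ _).trans (max_le_max h1 h2)
    have h4 : max (E * n + E) (E * k + E * n) ≤ E * n + E + E * k :=
      max_le (by omega) (by omega)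
    calc (s * G).totalDegree ≤ E + (E * n + E + E * k) :=
          (totalDegree_mul _ _).trans (add_le_add hds (h3.trans h4))
      _ = E * (k + 2 + n) := by ring
      _ ≤ E * ((k + 3) * n) := Nat.mul_le_mul le_rfl (by nlinarith)
      _ = B * n := by rw [hB]; ring
  obtain ⟨c, hc, hne⟩ := exists_eval_ne_zero_of_totalDegree_le (mul_ne_zero hs hG) hdeg
  set H : ℤ := A * ((B * n : ℕ) + 1) ^ D with hH
  have hH0 : 0 ≤ H := by positivity
  -- One base dominating `H`, `card κ * H`, `T.card` and 2, so that every bound below is a power of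
  -- `W`.
  set W : ℕ := w * (B * n + 1) ^ D with hW
  have hbound : ∀ f ∈ S', |eval c f| ≤ H := fun f hf => hA f hf _ c hc
  have hpos : (1 : ℤ) ≤ ((B * n : ℕ) + 1 : ℤ) ^ D := one_le_pow₀ (by omega)
  have hW2 : (2 : ℤ) ≤ W := by
    have : 2 ≤ w := by rw [hw]; nlinarith [Nat.zero_le (Fintype.card κ * (T.card+2) * (A+1)), Nat.zero_le (T.card * A)]
    have h2 : (2 : ℤ) ≤ w := by exact_mod_cast this
    rw [hW]; push_cast at hpos ⊢; nlinarith
  have hWH : ∀ x : ℕ, x ≤ (Fintype.card κ + 1) * (T.card + 2) → x * H ≤ W := fun x hx => by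
    rw [hW, hH, ← mul_assoc]
    push_cast
    refine mul_le_mul_of_nonneg_right ?_ (by positivity)
    have : x * A ≤ w := by rw [hw]; exact Nat.mul_le_mul hx (Nat.le_succ A)
    exact_mod_cast this
  have hHW : H ≤ W := by
    have := hWH 1 (by nlinarith [Nat.zero_le (Fintype.card κ * (T.card+2))]); simpa using this
  have hNW : (Fintype.card κ : ℤ) * H ≤ W := hWH _ (by nlinarith [Nat.zero_le (Fintype.card κ * T.card)])
  have hTW : (T.card : ℤ) ≤ W := by
    have : T.card ≤ w := by
      rw [hw]; nlinarith [Nat.zero_le (Fintype.card κ * (T.card+2) * (A+1)), Nat.zero_le (T.card * A)]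
    have h2 : (T.card : ℤ) ≤ w := by exact_mod_cast this
    rw [hW]; push_cast at hpos ⊢; nlinarith
  have hW1 : (1 : ℤ) ≤ W := by linarith
  have hval : |eval c (s * G)| ≤ (W : ℤ) ^ (n + k + 3) := by
    have h1 : |eval c (s ^ l.length * g)| ≤ (W : ℤ) ^ (n + k + 1) := by
      rw [map_mul, map_pow, abs_mul, abs_pow]
      calc |eval c s| ^ l.length * |eval c g| ≤ (W : ℤ) ^ l.length * W :=
            mul_le_mul (pow_le_pow_left₀ (abs_nonneg _) ((hbound s hmems).trans hHW) _)
              ((hbound g hmemg).trans hHW) (abs_nonneg _) (by positivity)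
        _ = (W : ℤ) ^ (l.length + 1) := by ring
        _ ≤ _ := pow_le_pow_right₀ hW1 (by omega)
    have h2 : |eval c (s ^ k * ∑ q ∈ T, l.prod q.1 q.2)| ≤ (W : ℤ) ^ (n + k + 1) := by
      rw [map_mul, map_pow, abs_mul, abs_pow, map_sum]
      have h3 : |∑ q ∈ T, eval c (l.prod q.1 q.2)| ≤ W * (W : ℤ) ^ l.length := by
        refine (Finset.abs_sum_le_sum_abs _ _).trans ?_
        have : ∀ q ∈ T, |eval c (l.prod q.1 q.2)| ≤ (W : ℤ) ^ l.length := fun q _ =>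
          (abs_eval_list_prod_apply_le hH0 c l
            (fun U hU i j => hbound _ (hmem U (hl U hU) i j)) _ _).trans
            (pow_le_pow_left₀ (by positivity) hNW _)
        refine (Finset.sum_le_card_nsmul _ _ _ this).trans ?_
        rw [nsmul_eq_mul]
        exact mul_le_mul_of_nonneg_right hTW (by positivity)
      calc |eval c s| ^ k * |∑ q ∈ T, eval c (l.prod q.1 q.2)|
          ≤ (W : ℤ) ^ k * (W * (W : ℤ) ^ l.length) :=
            mul_le_mul (pow_le_pow_left₀ (abs_nonneg _) ((hbound s hmems).trans hHW) _)
              h3 (abs_nonneg _) (by positivity)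
        _ = (W : ℤ) ^ (k + 1 + l.length) := by ring
        _ ≤ _ := pow_le_pow_right₀ hW1 (by omega)
    have h4 : |eval c G| ≤ (W : ℤ) ^ (n + k + 2) := by
      rw [hGdef, map_sub]
      refine (abs_sub _ _).trans ?_
      rw [pow_succ _ (n + k + 1)]
      nlinarith [pow_pos (show (0 : ℤ) < W by linarith) (n + k + 1)]
    rw [map_mul, abs_mul]
    calc |eval c s| * |eval c G| ≤ W * (W : ℤ) ^ (n + k + 2) :=
          mul_le_mul ((hbound s hmems).trans hHW) h4 (abs_nonneg _) (by positivity)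
      _ = _ := by ring
  -- A crude estimate, linear in `n` where a logarithm would do; any polynomial bound suffices.
  have hWL : W ≤ 2 ^ (w + D * (B * n + 1)) := by
    rw [hW, pow_add, mul_comm D, pow_mul 2 (B * n + 1) D]
    exact Nat.mul_le_mul Nat.lt_two_pow_self.le (Nat.pow_le_pow_left Nat.lt_two_pow_self.le _)
  have hz : (eval c (s * G)).natAbs ≤ 2 ^ ((w + D * (B * n + 1)) * (n + k + 3)) := by
    rw [pow_mul]
    refine le_trans ?_ (Nat.pow_le_pow_left hWL _)
    zify; exact_mod_cast hval
  obtain ⟨p, hp, hple, hpd⟩ := exists_prime_le_not_dvd (Int.natAbs_ne_zero.2 hne) hz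
  refine ⟨c, p, hp, hple.trans (sixteen_mul_sq_le_mul_pow_four w D B k hn), fun h => hpd (Int.natCast_dvd.1 h)⟩
end MvPolynomial

/-! ### Matrix models of the coefficient ring and their reductions -/

open MvPolynomial in
theorem exists_subring_injective_matrix {E : Set ℂ} (hE : E.Finite) :
    ∃ (σ : Type) (_ : Finite σ) (R : Subring ℂ) (e : ℕ)
      (f : R →+* Matrix (Fin e) (Fin e) (FractionRing (MvPolynomial σ ℤ))),
      E ⊆ R ∧ Function.Injective f := by
  obtain ⟨B, -, hB⟩ := exists_maximal_algebraicIndependent (R := ℤ) (∅ : Set ℂ) E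
    (Set.empty_subset _) ((algebraicIndependent_empty_iff ℤ ℂ).2 Int.cast_injective)
  obtain ⟨⟨hind, hBE⟩, hmax⟩ := hB
  replace hind : AlgebraicIndependent ℤ ((↑) : B → ℂ) := hind
  have hinj : Function.Injective (aeval ((↑) : B → ℂ) : MvPolynomial B ℤ →ₐ[ℤ] ℂ) := hind
  let _ : Algebra (FractionRing (MvPolynomial B ℤ)) ℂ :=
    RingHom.toAlgebra (IsFractionRing.lift (A := MvPolynomial B ℤ) (g := (aeval ((↑) : B → ℂ) :
      MvPolynomial B ℤ →ₐ[ℤ] ℂ).toRingHom) hinj)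
  have hmap : ∀ q : MvPolynomial B ℤ, algebraMap (FractionRing (MvPolynomial B ℤ)) ℂ
      (algebraMap _ _ q) = aeval ((↑) : B → ℂ) q := fun q =>
    IsFractionRing.lift_algebraMap (A := MvPolynomial B ℤ) hinj q
  have halg : ∀ x ∈ E, IsIntegral (FractionRing (MvPolynomial B ℤ)) x := by
    intro x hx
    -- By maximality of `B`: a transcendental `x` could be added to it.
    have hx' : IsAlgebraic (Algebra.adjoin ℤ (Set.range ((↑) : B → ℂ))) x := by
      by_contra htr
      have hxB : x ∉ B := fun hxB => htr <| isAlgebraic_algebraMap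
        (⟨x, Algebra.subset_adjoin ⟨⟨x, hxB⟩, rfl⟩⟩ :
          Algebra.adjoin ℤ (Set.range ((↑) : B → ℂ)))
      refine hxB (hmax (y := insert x B) ⟨?_, Set.insert_subset hx hBE⟩ (Set.subset_insert _ _)
        (Set.mem_insert _ _))
      refine (AlgebraicIndepOn.insert_iff hxB).2 ⟨hind, ?_⟩
      rw [Set.image_eq_range]
      exact htr
    refine (IsAlgebraic.ringHom_of_comp_eq
      ((algebraMap (MvPolynomial B ℤ) (FractionRing (MvPolynomial B ℤ))).comp
        hind.aevalEquiv.symm.toAlgHom.toRingHom) (RingHom.id ℂ) hx' ?_ ?_).isIntegral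
    · exact (IsFractionRing.injective _ _).comp hind.aevalEquiv.symm.injective
    · ext a
      obtain ⟨q, rfl⟩ := hind.aevalEquiv.surjective a
      simp [hmap, hind.algebraMap_aevalEquiv]
  have hfg := fg_adjoin_of_finite hE halg
  have : Module.Finite (FractionRing (MvPolynomial B ℤ))
    (Algebra.adjoin (FractionRing (MvPolynomial B ℤ)) E) := Module.Finite.iff_fg.2 hfg
  let b := Module.finBasis (FractionRing (MvPolynomial B ℤ))
    (Algebra.adjoin (FractionRing (MvPolynomial B ℤ)) E)
  exact ⟨B, (hE.subset hBE).to_subtype,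
    (Algebra.adjoin (FractionRing (MvPolynomial B ℤ)) E).toSubring, _,
    (Algebra.leftMulMatrix b).toRingHom, Algebra.subset_adjoin, Algebra.leftMulMatrix_injective b⟩

/-- Since `τ s` is a unit, `τ` extends to `P[1/s]`; `R₀` is the preimage under `f` of the matrices
over `P[1/s]`. The last clause computes `r` through numerators alone. -/
theorem exists_subring_reduction {P k R n : Type*} [CommRing P] [IsDomain P] [Field k] [CommRing R]
    [Fintype n] [DecidableEq n] (f : R →+* Matrix n n (FractionRing P)) (τ : P →+* k) {s : P}
    (hs : τ s ≠ 0) :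
    ∃ (R₀ : Subring R) (r : R₀ →+* Matrix n n k),
      (∀ x : R, (∃ N : ℕ, ∀ i j, ∃ u : P, algebraMap P (FractionRing P) u =
        algebraMap P (FractionRing P) s ^ N * f x i j) → x ∈ R₀) ∧
      ∀ (x : R₀) (i j : n) (N : ℕ) (u : P), algebraMap P (FractionRing P) u =
        algebraMap P (FractionRing P) s ^ N * f x i j → τ u = τ s ^ N * r x i j := by
  have hs0 : s ≠ 0 := fun h => hs (by rw [h, map_zero])
  set L := Localization.Away s
  have hle : Submonoid.powers s ≤ nonZeroDivisors P := powers_le_nonZeroDivisors_of_noZeroDivisors hs0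
  let ι : L →+* FractionRing P :=
    IsLocalization.map (M := Submonoid.powers s) (T := nonZeroDivisors P) _ (RingHom.id P) hle
  have hι : ∀ u : P, ι (algebraMap P L u) = algebraMap P (FractionRing P) u := fun u => by
    rw [IsLocalization.map_eq hle u, RingHom.id_apply]
  have hιinj : Function.Injective ι :=
    IsLocalization.map_injective_of_injective' (Submonoid.powers s) P (FractionRing P)
      (f := RingHom.id P) (N := nonZeroDivisors P) hle
      zero_notMem_nonZeroDivisors Function.injective_id
  let t : L →+* k := IsLocalization.Away.lift (g := τ) s (isUnit_iff_ne_zero.2 hs)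
  have ht : ∀ u : P, t (algebraMap P L u) = τ u := fun u => IsLocalization.Away.lift_eq s _ u
  have hMinj : Function.Injective (ι.mapMatrix : Matrix n n L →+* _) := fun A B h => by
    ext i j
    exact hιinj (congrFun (congrFun h i) j)
  let e := RingEquiv.ofLeftInverse (Function.leftInverse_invFun hMinj)
  have he : ∀ y, (ι.mapMatrix : Matrix n n L →+* _) (e.symm y) = y := fun y =>
    congrArg Subtype.val (e.apply_symm_apply y)
  refine ⟨(ι.mapMatrix : Matrix n n L →+* _).range.comap f,
    (t.mapMatrix : Matrix n n L →+* _).comp (e.symm.toRingHom.comp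
      (f.restrict _ _ fun x hx => hx)), ?_, ?_⟩
  · rintro x ⟨N, hN⟩
    choose u hu using hN
    refine ⟨Matrix.of fun i j => algebraMap P L (u i j) * IsLocalization.Away.invSelf s ^ N, ?_⟩
    ext i j
    have h1 : ι (IsLocalization.Away.invSelf s) * algebraMap P (FractionRing P) s = 1 := by
      rw [← hι, ← map_mul, mul_comm, IsLocalization.Away.mul_invSelf, map_one]
    simp only [RingHom.mapMatrix_apply, Matrix.map_apply, Matrix.of_apply, map_mul, map_pow, hι, hu]
    rw [mul_right_comm, ← mul_pow, mul_comm (algebraMap _ _ s), h1, one_pow, one_mul]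
  · intro x i j N u hu
    have h1 := he ((f.restrict _ _ fun x hx => hx) x)
    set A := e.symm ((f.restrict _ _ fun x hx => hx) x) with hA
    have h2 : ι (A i j) = f x i j := congrFun (congrFun h1 i) j
    have h3 : algebraMap P L u = algebraMap P L s ^ N * A i j := by
      apply hιinj
      rw [map_mul, map_pow, hι, hι, h2, hu]
    have h4 := congrArg t h3
    rw [map_mul, map_pow, ht, ht] at h4
    exact h4

/-! ### Special linear groups over subrings and finite rings -/

theorem exists_specialLinearGroup_lift {Γ R n : Type*} [Group Γ] [CommRing R] [Fintype n]
    [DecidableEq n] (ρ : Γ →* Matrix.SpecialLinearGroup n R) {X : Set Γ}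
    (hX : Subgroup.closure X = ⊤) (R₀ : Subring R) (h : ∀ x ∈ X, ∀ i j, ρ x i j ∈ R₀) :
    ∃ ρ₀ : Γ →* Matrix.SpecialLinearGroup n R₀, ∀ g i j, (ρ₀ g i j : R) = ρ g i j := by
  let μ : Matrix.SpecialLinearGroup n R₀ →* Matrix.SpecialLinearGroup n R :=
    Matrix.SpecialLinearGroup.map R₀.subtype
  have hμ : Function.Injective μ := fun A B hAB => by
    ext i j
    exact congrArg (fun M : Matrix.SpecialLinearGroup n R => M i j) hAB
  have hr : ∀ g, ρ g ∈ μ.range := by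
    intro g
    have : Subgroup.closure X ≤ μ.range.comap ρ := by
      rw [Subgroup.closure_le]
      intro x hx
      refine ⟨⟨Matrix.of fun i j => ⟨ρ x i j, h x hx i j⟩, ?_⟩, ?_⟩
      · apply Subtype.val_injective
        have h1 := RingHom.map_det R₀.subtype (Matrix.of fun i j => (⟨ρ x i j, h x hx i j⟩ : R₀))
        refine h1.trans ?_
        exact (ρ x).2
      · ext i j
        rfl
    rw [hX] at this
    exact this (Subgroup.mem_top g)
  refine ⟨(MonoidHom.ofInjective hμ).symm.toMonoidHom.comp (ρ.codRestrict _ hr), fun g i j => ?_⟩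
  have := (MonoidHom.ofInjective hμ).apply_symm_apply (ρ.codRestrict _ hr g)
  exact congrArg (fun M : μ.range => M.1 i j) this

theorem natCard_specialLinearGroup_le {S : Type*} [CommRing S] [Finite S] (m : ℕ) :
    Nat.card (Matrix.SpecialLinearGroup (Fin m) S) ≤ Nat.card S ^ (m * m) := by
  refine (Nat.card_le_card_of_injective _
    (Subtype.val_injective : Function.Injective
      ((↑) : Matrix.SpecialLinearGroup (Fin m) S → Matrix (Fin m) (Fin m) S))).trans (le_of_eq ?_)
  simp [Matrix, Nat.card_fun, pow_mul]

theorem not_isConj_of_trace_ne {R : Type*} [CommRing R] {m : ℕ}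
    {A B : Matrix.SpecialLinearGroup (Fin m) R}
    (h : Matrix.trace (A : Matrix (Fin m) (Fin m) R) ≠ Matrix.trace (B : Matrix (Fin m) (Fin m) R)) :
    ¬ IsConj A B := by
  intro hAB
  obtain ⟨c, rfl⟩ := isConj_iff.1 hAB
  apply h
  have h1 : c⁻¹ * (c * A) = A := inv_mul_cancel_left c A
  calc Matrix.trace (A : Matrix (Fin m) (Fin m) R)
      = Matrix.trace ((c⁻¹ : Matrix.SpecialLinearGroup (Fin m) R).1 * (c * A).1) :=
        congrArg (fun M : Matrix.SpecialLinearGroup (Fin m) R => Matrix.trace M.1) h1.symm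
    _ = _ := Matrix.trace_mul_comm _ _

/-! ### Flattened representations and clearing denominators -/

section
variable {Γ R F n e : Type*} [Group Γ] [CommRing R] [CommRing F] [Fintype n] [DecidableEq n]
  [Fintype e] [DecidableEq e]

/-- The matrices indexed by `n × e` attached to a representation over `R` and a matrix
representation of `R`. -/
def flatRep (ρ : Γ →* Matrix.SpecialLinearGroup n R) (f : R →+* Matrix e e F) :
    Γ →* Matrix (n × e) (n × e) F :=
  ((Matrix.compRingEquiv n e F).toRingHom.comp f.mapMatrix).toMonoidHom.comp
    { toFun := fun g => (ρ g).1
      map_one' := by rw [map_one]; rfl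
      map_mul' := fun g h => by rw [map_mul]; rfl }

/-- The positions of the flattened matrix that contribute to the entry `(i, j)` of the image of
the trace. -/
def tracePositions (n : Type*) {e : Type*} [Fintype n] (i j : e) : Finset ((n × e) × (n × e)) :=
  Finset.univ.map ⟨fun a : n => ((a, i), (a, j)), fun a b h => by simpa using h⟩

theorem sum_tracePositions_flatRep (ρ : Γ →* Matrix.SpecialLinearGroup n R)
    (f : R →+* Matrix e e F) (g : Γ) (i j : e) :
    ∑ q ∈ tracePositions n i j, flatRep ρ f g q.1 q.2 =
      f (Matrix.trace (ρ g : Matrix n n R)) i j := by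
  rw [tracePositions, Finset.sum_map, Matrix.trace, map_sum, Matrix.sum_apply]
  rfl

theorem list_prod_map_eq_pow_smul {α P F κ : Type*} [Monoid α] [CommRing P] [CommRing F] [Algebra P F]
    [Fintype κ] [DecidableEq κ] (Φ : α →* Matrix κ κ F) (U : α → Matrix κ κ P) (s : P)
    (l : List α) (h : ∀ y ∈ l, (U y).map (algebraMap P F) = s • Φ y) :
    (l.map U).prod.map (algebraMap P F) = s ^ l.length • Φ l.prod := by
  induction l with
  | nil => simp
  | cons y l ih =>
    rw [List.map_cons, List.prod_cons, Matrix.map_mul, h y (by simp),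
      ih fun z hz => h z (by simp [hz]), List.prod_cons, map_mul, List.length_cons, pow_succ',
      Matrix.smul_mul, Matrix.mul_smul, smul_smul]
end

/-! ### The separating finite quotient -/

theorem exists_finite_quotient_trace {Γ : Type*} [Group Γ] {σ R : Type} [Finite σ] [CommRing R]
    {m e : ℕ} (ρ : Γ →* Matrix.SpecialLinearGroup (Fin m) R)
    (f : R →+* Matrix (Fin e) (Fin e) (FractionRing (MvPolynomial σ ℤ)))
    (hf : Function.Injective f) {X : Set Γ} (hXf : X.Finite) (hX : Subgroup.closure X = ⊤)
    (γ : Γ) :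
    ∃ C : ℕ, ∀ n : ℕ, 1 ≤ n → ∀ l : List Γ, (∀ x ∈ l, x ∈ X ∨ x⁻¹ ∈ X) → l.length ≤ n →
      Matrix.trace (ρ γ : Matrix (Fin m) (Fin m) R) ≠
        Matrix.trace (ρ l.prod : Matrix (Fin m) (Fin m) R) →
      ∃ (Q : Type) (_ : Group Q) (_ : Finite Q) (φ : Γ →* Q), ¬ IsConj (φ γ) (φ l.prod) ∧
        Nat.card Q ≤ (C * n ^ 4) ^ (e * e * (m * m)) := by
  set Y : Set Γ := {x | x ∈ X ∨ x⁻¹ ∈ X} with hY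
  have hYf : Y.Finite := hXf.union (hXf.preimage inv_injective.injOn)
  obtain ⟨lγ, hlγ, hlγp⟩ : ∃ l : List Γ, (∀ x ∈ l, x ∈ Y) ∧ l.prod = γ :=
    Submonoid.exists_list_of_mem_closure (s := X ∪ X⁻¹) <| by
      rw [← Subgroup.closure_toSubmonoid, hX]
      exact Subgroup.mem_top γ
  have := hYf.to_subtype
  obtain ⟨⟨s, hs⟩, hsU⟩ := IsLocalization.exist_integer_multiples_of_finite
    (nonZeroDivisors (MvPolynomial σ ℤ)) (S := FractionRing (MvPolynomial σ ℤ))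
    (fun x : Y × (Fin m × Fin e) × (Fin m × Fin e) => flatRep ρ f x.1 x.2.1 x.2.2)
  choose u hu using hsU
  classical
  let U : Γ → Matrix (Fin m × Fin e) (Fin m × Fin e) (MvPolynomial σ ℤ) := fun g =>
    if hg : g ∈ Y then Matrix.of fun a b => u (⟨g, hg⟩, a, b) else 0
  have hU : ∀ y ∈ Y, (U y).map (algebraMap _ (FractionRing (MvPolynomial σ ℤ))) =
      s • flatRep ρ f y := fun y hy => by
    ext a b
    simp only [U, dif_pos hy]
    exact hu (⟨y, hy⟩, a, b)
  have hsum : ∀ l : List Γ, (∀ y ∈ l, y ∈ Y) → ∀ i j,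
      algebraMap _ (FractionRing (MvPolynomial σ ℤ))
        (∑ q ∈ tracePositions (Fin m) i j, (l.map U).prod q.1 q.2) =
      algebraMap _ (FractionRing (MvPolynomial σ ℤ)) s ^ l.length *
        f (Matrix.trace (ρ l.prod : Matrix (Fin m) (Fin m) R)) i j := fun l hl i j => by
    have h1 := list_prod_map_eq_pow_smul (flatRep ρ f) U s l fun y hy => hU y (hl y hy)
    rw [← sum_tracePositions_flatRep, map_sum, Finset.mul_sum]
    refine Finset.sum_congr rfl fun q _ => ?_
    have h2 := congrFun (congrFun h1 q.1) q.2
    rw [Matrix.smul_apply, Algebra.smul_def, map_pow] at h2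
    exact h2
  have hs0 : s ≠ 0 := nonZeroDivisors.ne_zero hs
  choose C hC using fun i j => MvPolynomial.exists_prime_not_dvd_eval (hYf.image U) s
    (∑ q ∈ tracePositions (Fin m) i j, (lγ.map U).prod q.1 q.2) hs0 lγ.length
    (tracePositions (Fin m) i j)
  refine ⟨∑ i, ∑ j, C i j, fun n hn l hl hln htr => ?_⟩
  obtain ⟨i, j, hij⟩ : ∃ i j, f (Matrix.trace (ρ γ : Matrix (Fin m) (Fin m) R)) i j ≠
      f (Matrix.trace (ρ l.prod : Matrix (Fin m) (Fin m) R)) i j := by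
    by_contra! h
    exact htr (hf (Matrix.ext h))
  have hγs := hsum lγ hlγ i j
  have hls := hsum l hl i j
  have hCij := hC i j n hn (l.map U)
    (fun V hV => by
      obtain ⟨y, hy, rfl⟩ := List.mem_map.1 hV
      exact ⟨y, hl y hy, rfl⟩) (by simpa using hln)
  rw [List.length_map] at hCij
  set g := ∑ q ∈ tracePositions (Fin m) i j, (lγ.map U).prod q.1 q.2
  set h := ∑ q ∈ tracePositions (Fin m) i j, (l.map U).prod q.1 q.2
  rw [hlγp] at hγs
  -- The cross factors bring both traces to the common denominator `s ^ (l.length + lγ.length)`.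
  have hG : s ^ l.length * g - s ^ lγ.length * h ≠ 0 := fun h0 => by
    have h1 := congrArg (algebraMap _ (FractionRing (MvPolynomial σ ℤ))) h0
    rw [map_sub, map_mul, map_mul, map_pow, map_pow, hγs, hls, map_zero, mul_left_comm,
      ← mul_sub, ← mul_sub] at h1
    have h2 : algebraMap _ (FractionRing (MvPolynomial σ ℤ)) s ≠ 0 := fun h3 =>
      hs0 (IsFractionRing.injective _ (FractionRing (MvPolynomial σ ℤ)) (h3.trans (map_zero _).symm))
    simp only [mul_eq_zero, pow_eq_zero_iff', h2, false_and, false_or, sub_eq_zero] at h1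
    exact hij h1
  obtain ⟨c, p, hp, hpC, hpd⟩ := hCij hG
  have := Fact.mk hp
  let τ : MvPolynomial σ ℤ →+* ZMod p := (Int.castRingHom (ZMod p)).comp (MvPolynomial.eval c)
  have hτ : τ (s * (s ^ l.length * g - s ^ lγ.length * h)) ≠ 0 := fun h0 =>
    hpd ((ZMod.intCast_zmod_eq_zero_iff_dvd _ p).1 h0)
  rw [map_mul] at hτ
  obtain ⟨R₀, r, hR₀, hr⟩ := exists_subring_reduction f τ (left_ne_zero_of_mul hτ)
  obtain ⟨ρ₀, hρ₀⟩ := exists_specialLinearGroup_lift ρ hX R₀ fun x hx a b => by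
    refine hR₀ _ ⟨1, fun i j => ⟨U x (a, i) (b, j), ?_⟩⟩
    have h1 := congrFun (congrFun (hU x (Or.inl hx)) (a, i)) (b, j)
    rw [Matrix.smul_apply, Algebra.smul_def] at h1
    rw [pow_one]
    exact h1
  have htrace : ∀ g, ((Matrix.trace (ρ₀ g : Matrix (Fin m) (Fin m) R₀) : R₀) : R) =
      Matrix.trace (ρ g : Matrix (Fin m) (Fin m) R) := fun g => by
    rw [Matrix.trace, Matrix.trace, AddSubmonoidClass.coe_finsetSum]
    exact Finset.sum_congr rfl fun a _ => hρ₀ g a a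
  -- The quotient, unlike the full matrix ring it embeds in, is known to be commutative, so `SL`
  -- over it makes sense.
  let S := R₀ ⧸ RingHom.ker r
  have hinj : Function.Injective (RingHom.kerLift r) := RingHom.kerLift_injective r
  have : Finite S := Finite.of_injective _ hinj
  have hcardS : Nat.card S ≤ p ^ (e * e) := by
    refine (Nat.card_le_card_of_injective _ hinj).trans (le_of_eq ?_)
    simp [Matrix, pow_mul]
  let φ : Γ →* Matrix.SpecialLinearGroup (Fin m) S :=
    (Matrix.SpecialLinearGroup.map (Ideal.Quotient.mk (RingHom.ker r))).comp ρ₀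
  have hφ : ∀ g, Matrix.trace (φ g : Matrix (Fin m) (Fin m) S) =
      Ideal.Quotient.mk (RingHom.ker r) (Matrix.trace (ρ₀ g : Matrix (Fin m) (Fin m) R₀)) :=
    fun g => (AddMonoidHom.map_trace (Ideal.Quotient.mk (RingHom.ker r)).toAddMonoidHom _).symm
  refine ⟨Matrix.SpecialLinearGroup (Fin m) S, inferInstance,
    Finite.of_injective _ Subtype.val_injective, φ, not_isConj_of_trace_ne fun heq => ?_, ?_⟩
  · rw [hφ, hφ] at heq
    have h1 : r (Matrix.trace (ρ₀ γ : Matrix (Fin m) (Fin m) R₀)) =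
        r (Matrix.trace (ρ₀ l.prod : Matrix (Fin m) (Fin m) R₀)) :=
      congrArg (RingHom.kerLift r) heq
    have h2 := hr _ i j _ _ (by rw [htrace]; exact hγs)
    have h3 := hr _ i j _ _ (by rw [htrace]; exact hls)
    refine right_ne_zero_of_mul hτ ?_
    rw [map_sub, map_mul, map_mul, map_pow, map_pow, h2, h3, h1]
    ring
  · have hCle : C i j ≤ ∑ i, ∑ j, C i j :=
      (Finset.single_le_sum (f := fun j => C i j) (fun _ _ => Nat.zero_le _)
        (Finset.mem_univ j)).trans
        (Finset.single_le_sum (f := fun i => ∑ j, C i j) (fun _ _ => Nat.zero_le _)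
          (Finset.mem_univ i))
    calc _ ≤ Nat.card S ^ (m * m) := natCard_specialLinearGroup_le m
      _ ≤ (p ^ (e * e)) ^ (m * m) := Nat.pow_le_pow_left hcardS _
      _ = p ^ (e * e * (m * m)) := (pow_mul _ _ _).symm
      _ ≤ _ := Nat.pow_le_pow_left (hpC.trans (Nat.mul_le_mul hCle le_rfl)) _

/-! ### Words realizing lengths, and the theorem -/

theorem exists_list_of_wordLength_le {Γ : Type*} [Group Γ] {X : Set Γ} {g : Γ} {n : ℕ}
    (h : wordLength X g ≤ n) :
    ∃ l : List Γ, (∀ x ∈ l, x ∈ X ∨ x⁻¹ ∈ X) ∧ l.prod = g ∧ l.length ≤ n := by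
  rw [wordLength] at h
  rcases Set.eq_empty_or_nonempty {k : ℕ∞ | ∃ l : List Γ, (∀ x ∈ l, x ∈ X ∨ x⁻¹ ∈ X) ∧
    l.prod = g ∧ k = (l.length : ℕ∞)} with he | hne
  · rw [he, sInf_empty, top_le_iff] at h
    exact absurd h (ENat.natCast_ne_top n)
  · obtain ⟨l, h1, h2, h3⟩ := csInf_mem hne
    rw [h3] at h
    exact ⟨l, h1, h2, by exact_mod_cast h⟩

theorem exists_list_of_mem_classBall {Γ : Type*} [Group Γ] {X : Set Γ} {c : ConjClasses Γ} {n : ℕ}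
    (h : c ∈ classBall X n) :
    ∃ l : List Γ, (∀ x ∈ l, x ∈ X ∨ x⁻¹ ∈ X) ∧ ConjClasses.mk l.prod = c ∧ l.length ≤ n := by
  replace h : classLength X c ≤ n := h
  rw [classLength] at h
  obtain ⟨g, hg⟩ := ConjClasses.exists_rep c
  have hne : {k : ℕ∞ | ∃ g : Γ, ConjClasses.mk g = c ∧ k = wordLength X g}.Nonempty :=
    ⟨_, g, hg, rfl⟩
  obtain ⟨g', h1, h2⟩ := csInf_mem hne
  rw [h2] at h
  obtain ⟨l, hl, rfl, hln⟩ := exists_list_of_wordLength_le h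
  exact ⟨l, hl, h1, hln⟩

theorem theorem1p6 {Γ : Type*} [Group Γ] [Group.FG Γ] (hB : PropertyB Γ) (γ : Γ) :
    ∃ d : ℕ, ∀ X : Set Γ, X.Finite → Subgroup.closure X = ⊤ →
      Dominated (relConjComplexity X γ) (fun n : ℕ => (n : ℕ∞) ^ d) := by
  obtain ⟨m, ρ, hρ⟩ := hB γ
  -- `R`, `e` and `f` are built from this fixed `Z`, before `X` is given, so the exponent cannot
  -- depend on `X`.
  obtain ⟨Z, hZ⟩ := (Group.fg_def (G := Γ)).1 inferInstance
  obtain ⟨σ, _, R, e, f, hR, hf⟩ := exists_subring_injective_matrix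
    (E := (fun x : Γ × Fin m × Fin m => ρ x.1 x.2.1 x.2.2) '' ((Z : Set Γ) ×ˢ Set.univ))
    ((Z.finite_toSet.prod Set.finite_univ).image _)
  obtain ⟨ρ', hρ'⟩ := exists_specialLinearGroup_lift ρ hZ R fun x hx a b =>
    hR ⟨(x, a, b), ⟨hx, trivial⟩, rfl⟩
  have htrace : ∀ g, ((Matrix.trace (ρ' g : Matrix (Fin m) (Fin m) R) : R) : ℂ) =
      Matrix.trace (ρ g : Matrix (Fin m) (Fin m) ℂ) := fun g => by
    rw [Matrix.trace, Matrix.trace, AddSubmonoidClass.coe_finsetSum]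
    exact Finset.sum_congr rfl fun a _ => hρ' g a a
  refine ⟨4 * (e * e * (m * m)), fun X hXf hX => ?_⟩
  obtain ⟨C, hC⟩ := exists_finite_quotient_trace ρ' f hf hXf hX γ
  set D := e * e * (m * m)
  -- `C + 1` ensures positivity; the outer factor absorbs `C ^ D`.
  refine ⟨(C + 1) ^ D, by positivity, fun n hn => iSup₂_le ?_⟩
  rintro c ⟨hc, hcγ⟩
  obtain ⟨l, hl, rfl, hln⟩ := exists_list_of_mem_classBall hc
  have hconj : ¬ IsConj γ l.prod := fun h => hcγ (ConjClasses.mk_eq_mk_iff_isConj.2 h)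
  obtain ⟨Q, _, _, φ, hφ, hcard⟩ := hC n hn l hl hln fun h => hρ _ hconj <| by
    rw [← htrace, ← htrace, h]
  have hdepth : conjDepth (ConjClasses.mk γ) (ConjClasses.mk l.prod) ≤ (Nat.card Q : ℕ∞) :=
    sInf_le ⟨Q, _, inferInstance, φ, fun h => hφ <| ConjClasses.mk_eq_mk_iff_isConj.1 <|
      show ConjClasses.mk (φ γ) = ConjClasses.mk (φ l.prod) from h, rfl⟩
  refine hdepth.trans ?_
  have : Nat.card Q ≤ (C + 1) ^ D * ((C + 1) ^ D * n) ^ (4 * D) := by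
    refine hcard.trans ?_
    rw [mul_pow, ← pow_mul]
    refine Nat.mul_le_mul (Nat.pow_le_pow_left (Nat.le_succ C) _) (Nat.pow_le_pow_left ?_ _)
    exact Nat.le_mul_of_pos_left _ (by positivity)
  beta_reduce
  exact_mod_cast this
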